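/- Let $\mathbb{F}_q$ be a finite field with $q\ge 4$ elements, let $s,d$ be positive integers, and let $X=(\mathbb{F}_q^*)^s=\{P_1,\dots,P_n\}$. Let $I_X\subset \mathbb{F}_q[t_1,\dots,t_s]$ be the ideal of all polynomials vanishing on $X$, and let $\varphi:\mathbb{F}_q[t_1,\dots,t_s]/I_X\to\mathbb{F}_q^n$, $\varphi(f+I_X)=(f(P_1),\dots,f(P_n))$. Let $\mathcal{C}(d)$ be the image under $\varphi$ of the $\mathbb{F}_q$-subspace generated by the classes $t_1^{a_1}\cdots t_s^{a_s}+I_X$ with $a_i\in\{0,1\}$ for all $i$ and $\sum_i a_i=d$. A minimum weight codeword of $\mathcal{C}(d)$ is a nonzero codeword of least Hamming weight among the nonzero codewords. Call a polynomial monomially square-free if none of its monomials is divisible by $t_i^2$ for any $i$. Assume that $s<2d<2s$, and let $f\in\mathbb{F}_q[t_1,\dots,t_s]$ be a homogeneous, monomially square-free polynomial of degree $d$. Then $\varphi(f+I_X)$ is a minimum weight codeword of $\mathcal{C}(d)$ if and only if $f$ may be written as $$f=\alpha\,\prod_{i=1}^{s-d}\bigl(t_{b_i}+\alpha_i t_{c_i}\bigr)\prod_{\substack{1\le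 j\le s\\ j\notin A_f}}t_j,$$ where $\alpha,\alpha_1,\dots,\alpha_{s-d}\in\mathbb{F}_q^*$, the set $A_f=\{b_1,\dots,b_{s-d},c_1,\dots,c_{s-d}\}\subset\{1,\dots,s\}$ has $2(s-d)$ distinct elements, $b_1<\cdots<b_{s-d}$, and $b_i<c_i$ for all $i=1,\dots,s-d$; and when $f$ can be so written, the data $\alpha$, $(\alpha_i)$, $(b_i)$, $(c_i)$ are uniquely determined by $f$. Moreover, the number of minimum weight codewords of $\mathcal{C}(d)$ in this case is $$\frac{(q-1)^{s-d+1}\prod_{i=0}^{2s-2d-1}(s-i)}{(s-d)!\,2^{s-d}}.$$ -/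

import Mathlib

namespace HypersimplexCode

open MvPolynomial

/-- The points of the torus `X = (F_q^*)^s`. -/
abbrev Torus (K : Type*) [Field K] (s : ℕ) : Type _ := Fin s → Kˣ

/-- Evaluation of polynomials in `K[t_1, …, t_s]` at all the points of the torus. -/
noncomputable def evalTorus (K : Type*) [Field K] (s : ℕ) :
    MvPolynomial (Fin s) K →ₐ[K] (Torus K s → K) :=
  AlgHom.pi fun P => aeval fun i => (P i : K)

/-- `I_X`: the ideal of all polynomials that vanish at every point of the torus. -/
noncomputable def torusIdeal (K : Type*) [Field K] (s : ℕ) : Ideal (MvPolynomial (Fin s) K) :=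
  RingHom.ker (evalTorus K s)

/-- The evaluation map `φ : K[t]/I_X → K^n`, `f + I_X ↦ (f(P))_{P ∈ X}`, the coordinates of
`K^n` being indexed by the `n` points of the torus. -/
noncomputable def phi (K : Type*) [Field K] (s : ℕ) :
    (MvPolynomial (Fin s) K ⧸ torusIdeal K s) →ₐ[K] (Torus K s → K) :=
  Ideal.kerLiftAlg (evalTorus K s)

/-- On representatives, `φ` is evaluation. -/
theorem phi_mk (K : Type*) [Field K] (s : ℕ) (f : MvPolynomial (Fin s) K) (P : Torus K s) :
    phi K s (Ideal.Quotient.mk (torusIdeal K s) f) P = eval (fun i => (P i : K)) f := by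
  rfl

/-- `𝓛(d)`: the subspace of `K[t]/I_X` generated by the classes of the square-free monomials
of degree `d`. -/
noncomputable def monomialSpace (K : Type*) [Field K] (s d : ℕ) :
    Submodule K (MvPolynomial (Fin s) K ⧸ torusIdeal K s) :=
  Submodule.span K
    {x | ∃ a : Fin s →₀ ℕ, (∀ i, a i ≤ 1) ∧ ∑ i, a i = d ∧
      x = Ideal.Quotient.mk (torusIdeal K s) (monomial a 1)}

/-- The toric code `𝓒(d) = φ(𝓛(d))`. -/
noncomputable def code (K : Type*) [Field K] (s d : ℕ) : Submodule K (Torus K s → K) :=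
  (monomialSpace K s d).map (phi K s).toLinearMap

/-- `v` is a minimum weight codeword of the linear code `C`: a nonzero codeword whose Hamming
weight is the least among the nonzero codewords. -/
def IsMinWeightCodeword {K : Type*} [Field K] [DecidableEq K] {ι : Type*} [Fintype ι]
    (C : Submodule K (ι → K)) (v : ι → K) : Prop :=
  v ∈ C ∧ v ≠ 0 ∧ ∀ w ∈ C, w ≠ 0 → hammingNorm v ≤ hammingNorm w

/-- No monomial of `f` is a multiple of some `t_i ^ 2`. -/
def IsMonomiallySquareFree {K : Type*} [Field K] {s : ℕ} (f : MvPolynomial (Fin s) K) : Prop :=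
  ∀ m ∈ f.support, ∀ i, m i ≤ 1

/-- The parameters of a normalized product of `r` binomials `t_{b_i} + α_i t_{c_i}` in disjoint
pairs of variables: a scalar `α ≠ 0`, scalars `α_i ≠ 0`, and indices `b_i < c_i`, all `2 r` of
them distinct, with `b_1 < ⋯ < b_r`. -/
structure PairData (K : Type*) [Field K] (s r : ℕ) where
  lead : Kˣ
  coef : Fin r → Kˣ
  b : Fin r → Fin s
  c : Fin r → Fin s
  distinct : Function.Injective (Sum.elim b c)
  b_lt_c : ∀ i, b i < c i
  b_strictMono : StrictMono b

/-- The set `A = {b_1, …, b_r, c_1, …, c_r}`. -/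
def PairData.indexSet {K : Type*} [Field K] {s r : ℕ} (D : PairData K s r) : Finset (Fin s) :=
  Finset.univ.image D.b ∪ Finset.univ.image D.c

/-- The polynomial `α ∏ i, (t_{b_i} + α_i t_{c_i}) ∏_{j ∉ A} t_j`. -/
noncomputable def PairData.poly {K : Type*} [Field K] {s r : ℕ} (D : PairData K s r) :
    MvPolynomial (Fin s) K :=
  C (D.lead : K) * (∏ i, (X (D.b i) + C (D.coef i : K) * X (D.c i))) *
    ∏ j ∈ D.indexSetᶜ, X j

end HypersimplexCode

/-! Put N = q - 1. If f is homogeneous of degree e with degree at most 1 in each variable, write f =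
x_j g + h with g = ∂f/∂x_j and g, h free of x_j. On a fibre where g ≠ 0 at most one value of x_j
kills f, so N·wt(f) ≥ (N-1)·wt(g), with equality iff g and h have the same zeros
(`hammingNorm_affine`). Induction on e gives wt(f) ≥ ((N-1)/N)^e N^s for f ≠ 0
(`hammingNorm_torusEval_ge`).

If f attains this bound, so does each nonzero derivative g. A binomial factor of g then makes g,
hence h, hence f vanish on x_b + αx_c = 0, so the binomial divides f (`eq_binomial_mul_pderiv`,
which needs q ≥ 4). Its cofactor avoids x_b and x_c and is again extremal; thus f is a product of
binomials in disjoint pairs (`IsExtremal.exists_prod`).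

Inverting all coordinates and multiplying by t_1⋯t_s turns degree d into degree s - d, preserves
weights, and carries products of binomials to the stated form. As 2(s-d) ≤ s, the bound is attained,
so minimum weight means extremal.

For the count, forgetting the order of the pairs and the order within each pair gives a bijection
with scalars and embeddings of 2(s-d) indices. -/

namespace HypersimplexCode

open MvPolynomial

/-! ### Polynomials of degree at most one in each variable. -/

section SquareFree

variable {K σ : Type*} [Field K]

/-- Evaluation of a polynomial at the points of the torus `σ → Kˣ`. -/
noncomputable def torusEval (f : MvPolynomial σ K) (x : σ → Kˣ) : K :=
  eval (fun i => (x i : K)) f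

theorem eq_zero_of_torusEval [Fintype K] [Finite σ] {f : MvPolynomial σ K}
    (hdeg : ∀ i, f.degreeOf i + 1 < Fintype.card K) (h : ∀ x, torusEval f x = 0) : f = 0 := by
  classical
  refine MvPolynomial.eq_zero_of_eval_zero_at_prod_finset f (fun _ => Finset.univ.erase 0) ?_ ?_
  · intro i
    have := hdeg i
    rw [Finset.card_erase_of_mem (Finset.mem_univ _), Finset.card_univ]
    omega
  · intro x hx
    simp only [Finset.mem_erase, Finset.mem_univ, and_true] at hx
    exact h fun i => Units.mk0 (x i) (hx i)

theorem torusEval_update [DecidableEq σ] {f : MvPolynomial σ K} {j : σ} (h : f.degreeOf j = 0)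
    (x : σ → Kˣ) (u : Kˣ) : torusEval f (Function.update x j u) = torusEval f x := by
  refine MvPolynomial.eval₂Hom_congr' rfl (fun i hi _ => ?_) rfl
  have : i ≠ j := by
    rintro rfl
    obtain ⟨m, hm, hmi⟩ := (mem_vars_iff_mem_support i).1 hi
    have := monomial_le_degreeOf i hm
    rw [Finsupp.mem_support_iff] at hmi
    omega
  simp [this]

theorem degreeOf_pderiv_le (f : MvPolynomial σ K) (i j : σ) :
    (pderiv j f).degreeOf i ≤ f.degreeOf i := by
  classical
  rw [degreeOf_le_iff]
  intro m hm
  rw [mem_support_iff, coeff_pderiv] at hm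
  have := monomial_le_degreeOf i (mem_support_iff.2 (left_ne_zero_of_mul hm))
  simp only [Finsupp.add_apply] at this
  omega

theorem degreeOf_pderiv_self {f : MvPolynomial σ K} {j : σ} (h : f.degreeOf j ≤ 1) :
    (pderiv j f).degreeOf j = 0 := by
  classical
  rw [← Nat.le_zero, degreeOf_le_iff]
  intro m hm
  rw [mem_support_iff, coeff_pderiv] at hm
  have := monomial_le_degreeOf j (mem_support_iff.2 (left_ne_zero_of_mul hm))
  simp only [Finsupp.add_apply, Finsupp.single_eq_same] at this
  omega

/-- Differentiation multiplies a coefficient by an exponent, here equal to 1, so nothing is lost in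
positive characteristic. -/
theorem exists_pderiv_ne_zero {f : MvPolynomial σ K} (hf : ∀ i, f.degreeOf i ≤ 1) {e : ℕ}
    (hom : f.IsHomogeneous (e + 1)) (h0 : f ≠ 0) : ∃ j, pderiv j f ≠ 0 := by
  classical
  obtain ⟨m, hm⟩ := exists_coeff_ne_zero h0
  have hdeg := hom hm
  have hm0 : m ≠ 0 := by
    rintro rfl
    simp at hdeg
  obtain ⟨j, hj⟩ := Finsupp.ne_iff.1 hm0
  refine ⟨j, fun h => hm ?_⟩
  have h1 := coeff_pderiv (i := j) f (m - Finsupp.single j 1)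
  have hj' : m j ≠ 0 := hj
  have hle := (monomial_le_degreeOf j (mem_support_iff.2 hm)).trans (hf j)
  rw [tsub_add_cancel_of_le (Finsupp.single_le_iff.2 (by omega)), h] at h1
  have : m j - 1 = 0 := by omega
  simpa [this] using h1.symm

theorem degreeOf_sub_X_mul_pderiv {f : MvPolynomial σ K} {j : σ} (h : f.degreeOf j ≤ 1) :
    (f - X j * pderiv j f).degreeOf j = 0 := by
  classical
  rw [← Nat.le_zero, degreeOf_le_iff]
  intro m hm
  by_contra hmj
  rw [mem_support_iff] at hm
  apply hm
  have hm1 : j ∈ m.support := by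
    rw [Finsupp.mem_support_iff]; omega
  have hms : m - Finsupp.single j 1 + Finsupp.single j 1 = m :=
    tsub_add_cancel_of_le (Finsupp.single_le_iff.2 (by omega))
  rw [coeff_sub, coeff_X_mul', if_pos hm1, coeff_pderiv, hms]
  by_cases hf : coeff m f = 0
  · simp [hf]
  · have := monomial_le_degreeOf j (mem_support_iff.2 hf)
    have h1 : m j = 1 := by omega
    simp [h1]

theorem degreeOf_X_mul_le {f : MvPolynomial σ K} {i j : σ} (hij : i ≠ j) :
    (X j * f).degreeOf i ≤ f.degreeOf i := by
  rw [mul_comm, degreeOf_mul_X_of_ne _ hij]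

theorem degreeOf_sub_X_mul_pderiv_le (f : MvPolynomial σ K) {i j : σ} (hij : i ≠ j) :
    (f - X j * pderiv j f).degreeOf i ≤ f.degreeOf i :=
  (degreeOf_sub_le _ _ _).trans
    (max_le le_rfl ((degreeOf_X_mul_le hij).trans (degreeOf_pderiv_le f i j)))

theorem torusEval_split (f : MvPolynomial σ K) (j : σ) (x : σ → Kˣ) :
    torusEval f x =
      (x j : K) * torusEval (pderiv j f) x + torusEval (f - X j * pderiv j f) x := by
  simp [torusEval]

/-- A polynomial of degree at most one in each variable that vanishes on the subset
`x_b + α x_c = 0` of the torus is a multiple of `X_b + α X_c`. -/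
theorem eq_binomial_mul_pderiv [Fintype K] [Finite σ] (hq : 4 ≤ Fintype.card K)
    {f : MvPolynomial σ K} (hf : ∀ i, f.degreeOf i ≤ 1) {b c : σ} (hbc : b ≠ c) (α : Kˣ)
    (h : ∀ x : σ → Kˣ, (x b : K) + α * x c = 0 → torusEval f x = 0) :
    f = (X b + C (α : K) * X c) * pderiv b f := by
  classical
  have key : f - (X b + C (α : K) * X c) * pderiv b f
      = (f - X b * pderiv b f) - C (α : K) * (X c * pderiv b f) := by ring
  have hb := degreeOf_pderiv_self (hf b)
  have h2 : ∀ i, (C (α : K) * (X c * pderiv b f)).degreeOf i ≤ (X c * pderiv b f).degreeOf i :=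
    fun i => degreeOf_C_mul_le _ _ _
  have hb0 : (f - (X b + C (α : K) * X c) * pderiv b f).degreeOf b = 0 := by
    rw [key, ← Nat.le_zero]
    refine (degreeOf_sub_le _ _ _).trans (max_le (degreeOf_sub_X_mul_pderiv (hf b)).le ?_)
    exact (h2 b).trans ((degreeOf_X_mul_le hbc).trans hb.le)
  rw [← sub_eq_zero]
  refine eq_zero_of_torusEval (fun i => ?_) (fun x => ?_)
  -- Degree 2 can occur in `c`, from `X c * pderiv b f`; 2 < q - 1 is where q ≥ 4 enters.
  · suffices (f - (X b + C (α : K) * X c) * pderiv b f).degreeOf i ≤ 2 by omega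
    rcases eq_or_ne i b with rfl | hib
    · omega
    rw [key]
    refine (degreeOf_sub_le _ _ _).trans (max_le ?_ ((h2 i).trans ?_))
    · exact (degreeOf_sub_X_mul_pderiv_le f hib).trans ((hf i).trans one_le_two)
    · refine (degreeOf_mul_le _ _ _).trans ?_
      have h3 := (degreeOf_pderiv_le f i b).trans (hf i)
      have h4 : (X c : MvPolynomial σ K).degreeOf i ≤ 1 := by
        rw [degreeOf_X]; split_ifs <;> omega
      omega
  -- The difference is free of `X b`, so the point may be moved onto the zero set of the binomial.
  · rw [← torusEval_update hb0 x (-(α * x c))]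
    have h0 : (((Function.update x b (-(α * x c))) b : Kˣ) : K)
        + α * ((Function.update x b (-(α * x c))) c : Kˣ) = 0 := by
      simp [hbc.symm]
    have := h _ h0
    simp only [torusEval, map_sub, map_mul, map_add, eval_X, eval_C] at this ⊢
    rw [this, h0]; simp

/-- Up to a unit, `X c` times the cofactor is `f - X b * pderiv b f`, which has degree at most 1 in
`c`. -/
theorem degreeOf_cofactor {f : MvPolynomial σ K} (hf : ∀ i, f.degreeOf i ≤ 1) {b c : σ}
    (hbc : b ≠ c) (α : Kˣ) (h : f = (X b + C (α : K) * X c) * pderiv b f) :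
    (pderiv b f).degreeOf c = 0 := by
  classical
  by_cases h0 : pderiv b f = 0
  · simp [h0]
  have h1 : pderiv b f * X c = C ((α⁻¹ : Kˣ) : K) * (f - X b * pderiv b f) := by
    have : f - X b * pderiv b f = C (α : K) * X c * pderiv b f := by
      linear_combination h
    rw [this, ← mul_assoc, ← mul_assoc, ← C_mul]; simp [mul_comm]
  have h2 := (degreeOf_mul_X_eq_degreeOf_add_one_iff c (pderiv b f)).2 h0
  have h3 : (pderiv b f * X c).degreeOf c ≤ 1 := by
    rw [h1]
    exact (degreeOf_C_mul_le _ _ _).trans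
      ((degreeOf_sub_X_mul_pderiv_le f hbc.symm).trans (hf c))
  omega

end SquareFree

/-! ### Counting nonzero values along one coordinate. -/

section Counting

theorem hammingNorm_eq_sum {K ι : Type*} [Field K] [DecidableEq K] [Fintype ι] (F : ι → K) :
    hammingNorm F = ∑ x, if F x ≠ 0 then 1 else 0 := by
  rw [hammingNorm, Finset.card_filter]

variable {K σ : Type*} [Field K] [Fintype K] [DecidableEq K] [Fintype σ] [DecidableEq σ]

/-- Swapping `u` with the `j`-th coordinate of `x` is an involution on pairs `(x, u)`. -/
theorem sum_update_unit {M : Type*} [AddCommMonoid M] (φ : (σ → Kˣ) → M) (j : σ) :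
    ∑ x : σ → Kˣ, ∑ u : Kˣ, φ (Function.update x j u)
      = Fintype.card Kˣ • ∑ x : σ → Kˣ, φ x := by
  let e : Equiv.Perm ((σ → Kˣ) × Kˣ) :=
    Function.Involutive.toPerm (fun p => (Function.update p.1 j p.2, p.1 j))
      (fun p => by simp)
  calc ∑ x : σ → Kˣ, ∑ u : Kˣ, φ (Function.update x j u)
      = ∑ p : (σ → Kˣ) × Kˣ, φ (e p).1 := by rw [Fintype.sum_prod_type]; rfl
    _ = ∑ p : (σ → Kˣ) × Kˣ, φ p.1 := Equiv.sum_comp e fun p => φ p.1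
    _ = _ := by
      rw [Fintype.sum_prod_type, Finset.smul_sum]
      simp

theorem sum_affine_ne_zero (hK : 3 ≤ Fintype.card K) (g h : K) :
    (if g ≠ 0 then Fintype.card Kˣ - 1 else 0) ≤
        (∑ u : Kˣ, if (u : K) * g + h ≠ 0 then 1 else 0) ∧
      ((∑ u : Kˣ, if (u : K) * g + h ≠ 0 then 1 else 0) =
        (if g ≠ 0 then Fintype.card Kˣ - 1 else 0) ↔ (g = 0 ↔ h = 0)) := by
  have hN : Fintype.card Kˣ = Fintype.card K - 1 := Fintype.card_units K
  by_cases hg : g = 0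
  · by_cases hh : h = 0
    · simp [hg, hh]
    · simp [hg, hh]
  · by_cases hh : h = 0
    · simp [hg, hh]; omega
    · have : (∑ u : Kˣ, if (u : K) * g + h ≠ 0 then 1 else 0) = Fintype.card Kˣ - 1 := by
        rw [← Finset.card_filter]
        have : Finset.univ.filter (fun u : Kˣ => (u : K) * g + h ≠ 0)
            = Finset.univ.erase (Units.mk0 (-h / g) (div_ne_zero (neg_ne_zero.2 hh) hg)) := by
          ext u
          simp only [Finset.mem_filter, Finset.mem_univ, true_and, Finset.mem_erase, and_true,
            ne_eq, Units.ext_iff, Units.val_mk0, eq_div_iff hg, eq_neg_iff_add_eq_zero]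
        rw [this, Finset.card_erase_of_mem (Finset.mem_univ _), Finset.card_univ]
      rw [this]; simp [hg, hh]

/-- The weight of `x_j g + h`, with `g` and `h` independent of `x_j`, is at least
`(q - 2) / (q - 1)` times that of `g`, with equality iff `g` and `h` have the same zeros. -/
theorem hammingNorm_affine (hK : 3 ≤ Fintype.card K) (j : σ) (F g h : (σ → Kˣ) → K)
    (hg : ∀ x u, g (Function.update x j u) = g x) (hh : ∀ x u, h (Function.update x j u) = h x)
    (hF : ∀ x, F x = (x j : K) * g x + h x) :
    (Fintype.card Kˣ - 1) * hammingNorm g ≤ Fintype.card Kˣ * hammingNorm F ∧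
      (Fintype.card Kˣ * hammingNorm F = (Fintype.card Kˣ - 1) * hammingNorm g ↔
        ∀ x, g x = 0 ↔ h x = 0) := by
  have e1 : (Fintype.card Kˣ - 1) * hammingNorm g
      = ∑ x, if g x ≠ 0 then Fintype.card Kˣ - 1 else 0 := by
    rw [hammingNorm_eq_sum, Finset.mul_sum]; simp
  have e2 : Fintype.card Kˣ * hammingNorm F
      = ∑ x, ∑ u : Kˣ, if (u : K) * g x + h x ≠ 0 then 1 else 0 := by
    rw [hammingNorm_eq_sum, ← smul_eq_mul, ← sum_update_unit _ j]
    simp only [hF, hg, hh, Function.update_self]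
  rw [e1, e2]
  refine ⟨Finset.sum_le_sum fun x _ => (sum_affine_ne_zero hK (g x) (h x)).1, ?_⟩
  rw [eq_comm, Finset.sum_eq_sum_iff_of_le
    fun x _ => (sum_affine_ne_zero hK (g x) (h x)).1]
  simp only [Finset.mem_univ, true_imp_iff]
  exact forall_congr' fun x => eq_comm.trans (sum_affine_ne_zero hK (g x) (h x)).2

end Counting

/-! ### The weight bound and its extremal polynomials. -/

section Extremal

variable {K σ : Type*} [Field K] [Fintype K] [DecidableEq K] [Fintype σ] [DecidableEq σ]

theorem torusEval_affine (hK : 3 ≤ Fintype.card K) {f : MvPolynomial σ K}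
    (hf : ∀ i, f.degreeOf i ≤ 1) (j : σ) :
    (Fintype.card Kˣ - 1) * hammingNorm (torusEval (pderiv j f)) ≤
        Fintype.card Kˣ * hammingNorm (torusEval f) ∧
      (Fintype.card Kˣ * hammingNorm (torusEval f) =
          (Fintype.card Kˣ - 1) * hammingNorm (torusEval (pderiv j f)) ↔
        ∀ x, torusEval (pderiv j f) x = 0 ↔ torusEval (f - X j * pderiv j f) x = 0) :=
  hammingNorm_affine hK j _ _ _ (fun x u => torusEval_update (degreeOf_pderiv_self (hf j)) x u)
    (fun x u => torusEval_update (degreeOf_sub_X_mul_pderiv (hf j)) x u)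
    (fun x => torusEval_split f j x)

/-- The equality case of `hammingNorm_affine`: `G` and `α x_c G` have the same zeros on the torus.
-/
theorem hammingNorm_binomial_mul (hK : 3 ≤ Fintype.card K) {b c : σ} (hbc : b ≠ c) (α : Kˣ)
    (G : (σ → Kˣ) → K) (hG : ∀ x u, G (Function.update x b u) = G x) :
    Fintype.card Kˣ * hammingNorm (fun x : σ → Kˣ => ((x b : K) + α * x c) * G x) =
      (Fintype.card Kˣ - 1) * hammingNorm G :=
  (hammingNorm_affine hK b _ G (fun x => α * x c * G x) hG
    (fun x u => by simp [hG, hbc.symm]) (fun x => by ring)).2.2 (fun x => by simp)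

/-- Each nonzero derivative costs a factor (N-1)/N, down to a nonzero constant, which has full
weight. -/
theorem hammingNorm_torusEval_ge (hK : 3 ≤ Fintype.card K) (e : ℕ) {f : MvPolynomial σ K}
    (hf : ∀ i, f.degreeOf i ≤ 1) (hom : f.IsHomogeneous e) (h0 : f ≠ 0) :
    (Fintype.card Kˣ - 1) ^ e * Fintype.card (σ → Kˣ) ≤
      Fintype.card Kˣ ^ e * hammingNorm (torusEval f) := by
  induction e generalizing f with
  | zero =>
    obtain ⟨a, rfl⟩ : ∃ a, f = C a :=
      ⟨_, totalDegree_eq_zero_iff_eq_C.1 (Nat.le_zero.1 hom.totalDegree_le)⟩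
    have ha : a ≠ 0 := by rintro rfl; simp at h0
    simp [hammingNorm_eq_sum, torusEval, ha]
  | succ e ih =>
    obtain ⟨j, hj⟩ := exists_pderiv_ne_zero hf hom h0
    have h1 := ih (fun i => (degreeOf_pderiv_le f i j).trans (hf i)) (by simpa using hom.pderiv) hj
    have h2 := (torusEval_affine hK hf j).1
    calc _ = (Fintype.card Kˣ - 1) * ((Fintype.card Kˣ - 1) ^ e * Fintype.card (σ → Kˣ)) := by
          ring
      _ ≤ (Fintype.card Kˣ - 1) * (Fintype.card Kˣ ^ e * hammingNorm (torusEval (pderiv j f))) :=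
          Nat.mul_le_mul_left _ h1
      _ = Fintype.card Kˣ ^ e *
            ((Fintype.card Kˣ - 1) * hammingNorm (torusEval (pderiv j f))) := by ring
      _ ≤ Fintype.card Kˣ ^ e * (Fintype.card Kˣ * hammingNorm (torusEval f)) :=
          Nat.mul_le_mul_left _ h2
      _ = _ := by ring

/-- The polynomial `f` attains the bound of `hammingNorm_torusEval_ge`. -/
def IsExtremal (e : ℕ) (f : MvPolynomial σ K) : Prop :=
  Fintype.card Kˣ ^ e * hammingNorm (torusEval f) =
    (Fintype.card Kˣ - 1) ^ e * Fintype.card (σ → Kˣ)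

theorem IsExtremal.exists_torusEval_ne_zero (hK : 3 ≤ Fintype.card K) {e : ℕ}
    {f : MvPolynomial σ K} (h : IsExtremal e f) : ∃ x, torusEval f x ≠ 0 := by
  by_contra! hc
  have h0 : torusEval f = 0 := funext hc
  have hN : Fintype.card Kˣ = Fintype.card K - 1 := Fintype.card_units K
  have hpos : 0 < (Fintype.card Kˣ - 1) ^ e * Fintype.card (σ → Kˣ) :=
    Nat.mul_pos (pow_pos (by omega) _) Fintype.card_pos
  rw [IsExtremal, h0, hammingNorm_zero] at h
  omega

theorem IsExtremal.ne_zero (hK : 3 ≤ Fintype.card K) {e : ℕ}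
    {f : MvPolynomial σ K} (h : IsExtremal e f) : f ≠ 0 := by
  obtain ⟨x, hx⟩ := h.exists_torusEval_ne_zero hK
  rintro rfl
  simp [torusEval] at hx

/-- Equality for `f` forces equality in both inequalities of the inductive step. -/
theorem IsExtremal.pderiv (hK : 3 ≤ Fintype.card K) {e : ℕ} {f : MvPolynomial σ K}
    (hf : ∀ i, f.degreeOf i ≤ 1) (hom : f.IsHomogeneous (e + 1)) (h : IsExtremal (e + 1) f)
    {j : σ} (hj : pderiv j f ≠ 0) :
    IsExtremal e (pderiv j f) ∧
      ∀ x, torusEval (MvPolynomial.pderiv j f) x = 0 ↔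
        torusEval (f - X j * MvPolynomial.pderiv j f) x = 0 := by
  have hN : Fintype.card Kˣ = Fintype.card K - 1 := Fintype.card_units K
  have h1 := hammingNorm_torusEval_ge hK e
    (fun i => (degreeOf_pderiv_le f i j).trans (hf i)) (by simpa using hom.pderiv) hj
  obtain ⟨h2, h3⟩ := torusEval_affine hK hf j
  have hM : 0 < Fintype.card Kˣ - 1 := by omega
  have hNe : 0 < Fintype.card Kˣ ^ e := pow_pos (by omega) _
  have h4 : Fintype.card Kˣ ^ e * (Fintype.card Kˣ * hammingNorm (torusEval f)) =
      (Fintype.card Kˣ - 1) * ((Fintype.card Kˣ - 1) ^ e * Fintype.card (σ → Kˣ)) := by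
    rw [IsExtremal, pow_succ, pow_succ] at h
    rw [← mul_assoc, h]; ring
  have h5 := Nat.mul_le_mul_left (Fintype.card Kˣ - 1) h1
  have h6 := Nat.mul_le_mul_left (Fintype.card Kˣ ^ e) h2
  have h7 : Fintype.card Kˣ ^ e * ((Fintype.card Kˣ - 1) * hammingNorm (torusEval
      (MvPolynomial.pderiv j f))) = (Fintype.card Kˣ - 1) * (Fintype.card Kˣ ^ e *
      hammingNorm (torusEval (MvPolynomial.pderiv j f))) := by ring
  refine ⟨?_, h3.1 (Nat.eq_of_mul_eq_mul_left hNe (by omega))⟩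
  exact Nat.eq_of_mul_eq_mul_left hM (by omega)

/-- Here the derivative is a nonzero constant, so the remainder has no zero on the torus. A linear
form with this property is a single term, leaving exactly two terms in `f`. -/
theorem exists_binomial_of_linear (hq : 4 ≤ Fintype.card K) {f : MvPolynomial σ K}
    (hf : ∀ i, f.degreeOf i ≤ 1) (hom : f.IsHomogeneous 1) (h : IsExtremal 1 f) :
    ∃ (b c : σ) (α : Kˣ), b ≠ c ∧ f = (X b + C (α : K) * X c) * pderiv b f := by
  have isC : ∀ {g : MvPolynomial σ K} (j : σ), g.IsHomogeneous 1 → pderiv j g ≠ 0 →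
      ∃ a : K, a ≠ 0 ∧ pderiv j g = C a := fun {g} j hg hj => by
    have h0 : (pderiv j g).IsHomogeneous 0 := hg.pderiv
    have h1 := totalDegree_eq_zero_iff_eq_C.1 (Nat.le_zero.1 h0.totalDegree_le)
    refine ⟨_, fun ha => hj ?_, h1⟩
    rw [h1, ha, C_0]
  obtain ⟨j, hj⟩ := exists_pderiv_ne_zero hf hom (h.ne_zero (by omega))
  obtain ⟨-, hsupp⟩ := h.pderiv (by omega) hf hom hj
  obtain ⟨γ, hγ, hγj⟩ := isC j hom hj
  have hsplit := torusEval_split f j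
  have hjh := degreeOf_sub_X_mul_pderiv (hf j)
  have hdeg : ∀ i, (f - X j * pderiv j f).degreeOf i ≤ 1 := fun i => by
    rcases eq_or_ne i j with rfl | hij
    · omega
    · exact (degreeOf_sub_X_mul_pderiv_le f hij).trans (hf i)
  have homh : (f - X j * pderiv j f).IsHomogeneous 1 := by
    have h1 := (isHomogeneous_X K j).mul (hom.pderiv (i := j))
    exact hom.sub h1
  generalize f - X j * pderiv j f = g at *
  rw [hγj] at hsupp hsplit
  simp only [torusEval, eval_C, hγ, false_iff] at hsupp
  have hg0 : g ≠ 0 := fun hg => hsupp 1 (by simp [hg])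
  obtain ⟨k, hk⟩ := exists_pderiv_ne_zero hdeg homh hg0
  have hkj : j ≠ k := by
    rintro rfl
    refine hk (pderiv_eq_zero_of_notMem_vars fun hm => ?_)
    obtain ⟨m, hm, hmi⟩ := (mem_vars_iff_mem_support j).1 hm
    have := monomial_le_degreeOf j hm
    rw [Finsupp.mem_support_iff] at hmi
    omega
  obtain ⟨β, hβ, hβk⟩ := isC k homh hk
  have hsplit' := torusEval_split g k
  have hkh := degreeOf_sub_X_mul_pderiv (hdeg k)
  generalize g - X k * pderiv k g = g' at *
  rw [hβk] at hsplit'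
  have hg' : ∀ x, torusEval g' x = 0 := by
    intro x
    by_contra hx
    -- If `g'` were nonzero at `x`, this choice of the `k`-th coordinate would be a zero of `β x_k +
    -- g'`.
    refine hsupp (Function.update x k (Units.mk0 (-torusEval g' x / β)
      (div_ne_zero (neg_ne_zero.2 hx) hβ))) ?_
    have := hsplit' (Function.update x k (Units.mk0 (-torusEval g' x / β)
      (div_ne_zero (neg_ne_zero.2 hx) hβ)))
    rw [torusEval_update hkh] at this
    refine this.trans ?_
    simp [torusEval, hβ]
  refine ⟨j, k, Units.mk0 (β / γ) (div_ne_zero hβ hγ), hkj,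
    eq_binomial_mul_pderiv hq hf hkj _ fun x hx => ?_⟩
  rw [hsplit, hsplit', hg']
  simp only [torusEval, eval_C, Units.val_mk0] at hx ⊢
  field_simp at hx
  linear_combination hx

/-- An extremal homogeneous square-free polynomial of positive degree has a binomial factor. -/
theorem IsExtremal.exists_binomial (hq : 4 ≤ Fintype.card K) (e : ℕ) {f : MvPolynomial σ K}
    (hf : ∀ i, f.degreeOf i ≤ 1) (hom : f.IsHomogeneous (e + 1)) (h : IsExtremal (e + 1) f) :
    ∃ (b c : σ) (α : Kˣ), b ≠ c ∧ f = (X b + C (α : K) * X c) * MvPolynomial.pderiv b f := by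
  induction e generalizing f with
  | zero => exact exists_binomial_of_linear hq hf hom h
  | succ e ih =>
    obtain ⟨j, hj⟩ := exists_pderiv_ne_zero hf hom (h.ne_zero (by omega))
    obtain ⟨hext, hsupp⟩ := h.pderiv (by omega) hf hom hj
    obtain ⟨b, c, α, hbc, hfac⟩ := ih (fun i => (degreeOf_pderiv_le f i j).trans (hf i))
      (by simpa using hom.pderiv) hext
    -- The binomial dividing the derivative also divides `f`: where it vanishes, so does the
    -- derivative, and then the remainder by equality of zero sets.
    refine ⟨b, c, α, hbc, eq_binomial_mul_pderiv hq hf hbc α fun x hx => ?_⟩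
    have hg : torusEval (MvPolynomial.pderiv j f) x = 0 := by
      rw [hfac]
      simp [torusEval, hx]
    rw [torusEval_split f j, hg, (hsupp x).1 hg]
    simp

/-- Extremal homogeneous square-free polynomials are products of binomials in disjoint pairs of
variables. -/
theorem IsExtremal.exists_prod (hq : 4 ≤ Fintype.card K) (e : ℕ) {f : MvPolynomial σ K}
    (hf : ∀ i, f.degreeOf i ≤ 1) (hom : f.IsHomogeneous e) (h : IsExtremal e f) :
    ∃ (a : Kˣ) (α : Fin e → Kˣ) (b c : Fin e → σ), Function.Injective (Sum.elim b c) ∧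
      f = C (a : K) * ∏ i, (X (b i) + C (α i : K) * X (c i)) := by
  induction e generalizing f with
  | zero =>
    obtain ⟨a, rfl⟩ : ∃ a, f = C a :=
      ⟨_, totalDegree_eq_zero_iff_eq_C.1 (Nat.le_zero.1 hom.totalDegree_le)⟩
    have ha : a ≠ 0 := fun ha => h.ne_zero (by omega) (by simp [ha])
    exact ⟨Units.mk0 a ha, Fin.elim0, Fin.elim0, Fin.elim0,
      fun x => x.elim (fun i => i.elim0) (fun i => i.elim0), by simp⟩
  | succ e ih =>
    obtain ⟨b, c, α, hbc, hfac⟩ := h.exists_binomial hq e hf hom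
    have hb := degreeOf_pderiv_self (hf b)
    have hc := degreeOf_cofactor hf hbc α hfac
    have hfg : ∀ i, (MvPolynomial.pderiv b f).degreeOf i ≤ 1 :=
      fun i => (degreeOf_pderiv_le f i b).trans (hf i)
    have homg : (MvPolynomial.pderiv b f).IsHomogeneous e := by simpa using hom.pderiv
    generalize MvPolynomial.pderiv b f = g at *
    have hg : IsExtremal e g := by
      have h1 := hammingNorm_binomial_mul (by omega) hbc α (torusEval g)
        (fun x u => torusEval_update hb x u)
      have h2 : torusEval f = fun x : σ → Kˣ => ((x b : K) + α * x c) * torusEval g x := by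
        funext x; rw [hfac]; simp [torusEval]
      have hN : Fintype.card Kˣ = Fintype.card K - 1 := Fintype.card_units K
      rw [IsExtremal, h2, pow_succ, mul_assoc, h1] at h
      refine Nat.eq_of_mul_eq_mul_left (show 0 < Fintype.card Kˣ - 1 by omega) ?_
      rw [mul_left_comm, h]; ring
    obtain ⟨a, α', b', c', hinj, hprod⟩ := ih hfg homg hg
    obtain ⟨x, hx⟩ := hg.exists_torusEval_ne_zero (by omega)
    have hev : ∀ y, torusEval g y = a * ∏ i, ((y (b' i) : K) + α' i * y (c' i)) := fun y => by
      rw [hprod]; simp [torusEval]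
    have hbc' : ∀ i, b' i ≠ c' i := fun i hi => by
      have := @hinj (Sum.inl i) (Sum.inr i) hi
      simp at this
    -- If a binomial of `g` involved a variable `g` does not depend on, changing that coordinate
    -- would kill the binomial without changing the nonzero value at `x`.
    have hnotb : ∀ j, g.degreeOf j = 0 → ∀ i, b' i ≠ j := by
      rintro j hj i rfl
      apply hx
      rw [← torusEval_update hj x (-(α' i * x (c' i))), hev]
      refine mul_eq_zero_of_right _ (Finset.prod_eq_zero (Finset.mem_univ i) ?_)
      simp [(hbc' i).symm]
    have hnotc : ∀ j, g.degreeOf j = 0 → ∀ i, c' i ≠ j := by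
      rintro j hj i rfl
      apply hx
      rw [← torusEval_update hj x (-((α' i)⁻¹ * x (b' i))), hev]
      refine mul_eq_zero_of_right _ (Finset.prod_eq_zero (Finset.mem_univ i) ?_)
      simp [hbc' i]
    refine ⟨a, Fin.cons α α', Fin.cons b b', Fin.cons c c', ?_, ?_⟩
    · rw [Sum.elim_injective] at hinj ⊢
      obtain ⟨i1, i2, i3⟩ := hinj
      refine ⟨?_, ?_, ?_⟩
      · rw [Fin.cons_injective_iff]
        exact ⟨by rintro ⟨i, hi⟩; exact hnotb b hb i hi, i1⟩
      · rw [Fin.cons_injective_iff]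
        exact ⟨by rintro ⟨i, hi⟩; exact hnotc c hc i hi, i2⟩
      · intro i k
        refine Fin.cases ?_ (fun i => ?_) i <;> refine Fin.cases ?_ (fun k => ?_) k
        · simpa using hbc
        · simpa using (hnotc b hb k).symm
        · simpa using hnotb c hc i
        · simpa using i3 i k
    · rw [Fin.prod_univ_succ]
      simp only [Fin.cons_zero, Fin.cons_succ]
      rw [hfac, hprod]; ring

end Extremal

/-! ### Passing from degree d to degree s - d by inverting coordinates. -/

section Dual

variable {K σ : Type*} [Field K] [Fintype σ]

/-- The complementary polynomial `t_1 ⋯ t_s f(1 / t_1, …, 1 / t_s)` of a square-free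
polynomial. -/
theorem exists_complement {d : ℕ} {f : MvPolynomial σ K} (hf : ∀ i, f.degreeOf i ≤ 1)
    (hom : f.IsHomogeneous d) :
    ∃ g : MvPolynomial σ K, (∀ i, g.degreeOf i ≤ 1) ∧ g.IsHomogeneous (Fintype.card σ - d) ∧
      ∀ x, torusEval g x = (∏ i, (x i : K)) * torusEval f x⁻¹ := by
  classical
  have hle : ∀ m ∈ f.support, ∀ i, m i ≤ 1 := fun m hm i => (monomial_le_degreeOf i hm).trans (hf i)
  -- The exponent of t_1⋯t_s; truncated subtraction `o - m` is exact because the exponents in `m`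
  -- are at most 1.
  let o : σ →₀ ℕ := Finsupp.equivFunOnFinite.symm 1
  refine ⟨∑ m ∈ f.support, monomial (o - m) (coeff m f), fun i => ?_, ?_, fun x => ?_⟩
  · refine (degreeOf_sum_le _ _ _).trans (Finset.sup_le fun m hm => ?_)
    rw [degreeOf_monomial_eq _ _ (mem_support_iff.1 hm)]
    simp [o]
  · refine IsHomogeneous.sum _ _ _ fun m hm => isHomogeneous_monomial _ ?_
    have h1 : m.degree = d := by
      have := hom (mem_support_iff.1 hm)
      rw [Finsupp.degree_eq_weight_one]
      exact this
    rw [← h1, Finsupp.degree_eq_sum, Finsupp.degree_eq_sum]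
    have : ∑ i, (o - m) i + ∑ i, m i = Fintype.card σ := by
      rw [← Finset.sum_add_distrib, ← Finset.card_univ, Finset.card_eq_sum_ones]
      refine Finset.sum_congr rfl fun i _ => ?_
      have := hle m hm i
      simp [o]; omega
    omega
  · rw [torusEval, torusEval, eval_sum, eval_eq', Finset.mul_sum]
    refine Finset.sum_congr rfl fun m hm => ?_
    rw [eval_monomial, Finsupp.prod_fintype _ _ (by simp), mul_left_comm,
      ← Finset.prod_mul_distrib]
    congr 1
    refine Finset.prod_congr rfl fun i _ => ?_
    have : m i = 0 ∨ m i = 1 := by have := hle m hm i; omega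
    rcases this with h | h <;> simp [o, h]

theorem hammingNorm_comp_inv [Fintype K] [DecidableEq K] [DecidableEq σ] {F G : (σ → Kˣ) → K}
    (h : ∀ x, G x = (∏ i, (x i : K)) * F x⁻¹) : hammingNorm G = hammingNorm F := by
  rw [hammingNorm_eq_sum, hammingNorm_eq_sum, ← Equiv.sum_comp (Equiv.inv (σ → Kˣ))]
  refine Finset.sum_congr rfl fun x _ => ?_
  have : ∏ i, ((x⁻¹ i : Kˣ) : K) ≠ 0 := Finset.prod_ne_zero_iff.2 fun i _ => Units.ne_zero _
  simp only [Equiv.inv_apply, h, inv_inv, ne_eq, mul_eq_zero, this, false_or]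

theorem hammingNorm_torusEval_ge_of_codegree [Fintype K] [DecidableEq K] [DecidableEq σ]
    (hK : 3 ≤ Fintype.card K) {d : ℕ} {f : MvPolynomial σ K}
    (hf : ∀ i, f.degreeOf i ≤ 1) (hom : f.IsHomogeneous d) (h0 : torusEval f ≠ 0) :
    (Fintype.card Kˣ - 1) ^ (Fintype.card σ - d) * Fintype.card (σ → Kˣ) ≤
      Fintype.card Kˣ ^ (Fintype.card σ - d) * hammingNorm (torusEval f) := by
  obtain ⟨g, hg, homg, hev⟩ := exists_complement hf hom
  have hn := hammingNorm_comp_inv hev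
  rw [← hn]
  refine hammingNorm_torusEval_ge hK _ hg homg ?_
  rintro rfl
  have : torusEval (0 : MvPolynomial σ K) = 0 := funext fun x => by simp [torusEval]
  rw [this, hammingNorm_zero] at hn
  exact h0 (hammingNorm_eq_zero.1 hn.symm)

theorem hammingNorm_prod_binomial [Fintype K] [DecidableEq K] [DecidableEq σ]
    (hK : 3 ≤ Fintype.card K) {ι : Type*} (b c : ι → σ)
    (hinj : Function.Injective (Sum.elim b c)) (α : ι → Kˣ) (T : Finset ι) :
    Fintype.card Kˣ ^ T.card *
        hammingNorm (fun x : σ → Kˣ => ∏ i ∈ T, ((x (b i) : K) + α i * x (c i))) =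
      (Fintype.card Kˣ - 1) ^ T.card * Fintype.card (σ → Kˣ) := by
  classical
  obtain ⟨hb, hc, hbc⟩ := Sum.elim_injective.1 hinj
  induction T using Finset.induction_on with
  | empty => simp [hammingNorm_eq_sum]
  | insert i T hi ih =>
    have h1 := hammingNorm_binomial_mul hK (hbc i i) (α i)
      (fun x : σ → Kˣ => ∏ i ∈ T, ((x (b i) : K) + α i * x (c i))) (fun x u =>
        Finset.prod_congr rfl fun k hk => by
          have h2 : b k ≠ b i := fun h => hi (hb h ▸ hk)
          have h3 : c k ≠ b i := (hbc i k).symm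
          simp [h2, h3])
    simp only [Finset.prod_insert hi, Finset.card_insert_of_notMem hi]
    rw [pow_succ, mul_assoc, h1, mul_left_comm, ih]
    ring

end Dual

/-! ### Sorting a family of disjoint pairs. -/

section Normalize

/-- Put the smaller index of each pair first, then sort by it; `τ` and `ε` record how to undo this.
-/
theorem exists_normalized {r s : ℕ} (b c : Fin r → Fin s)
    (hinj : Function.Injective (Sum.elim b c)) :
    ∃ (b' c' : Fin r → Fin s) (τ : Equiv.Perm (Fin r)) (ε : Fin r → Bool),
      Function.Injective (Sum.elim b' c') ∧ (∀ i, b' i < c' i) ∧ StrictMono b' ∧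
      (∀ k, b k = if ε k then b' (τ k) else c' (τ k)) ∧
      (∀ k, c k = if ε k then c' (τ k) else b' (τ k)) := by
  obtain ⟨hb, hc, hbc⟩ := Sum.elim_injective.1 hinj
  let m : Fin r → Fin s := fun k => min (b k) (c k)
  let M : Fin r → Fin s := fun k => max (b k) (c k)
  have hm : ∀ k, (m k = b k ∧ M k = c k ∧ b k < c k) ∨ (m k = c k ∧ M k = b k ∧ c k < b k) := by
    intro k
    rcases lt_or_gt_of_ne (hbc k k) with h | h
    · exact Or.inl ⟨min_eq_left h.le, max_eq_right h.le, h⟩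
    · exact Or.inr ⟨min_eq_right h.le, max_eq_left h.le, h⟩
  have hm_inj : Function.Injective m := fun i k h => by
    have hi := hm i; have hk := hm k
    have := @hb i k; have := @hc i k; have := hbc i k; have := hbc k i
    grind
  have hM_inj : Function.Injective M := fun i k h => by
    have hi := hm i; have hk := hm k
    have := @hb i k; have := @hc i k; have := hbc i k; have := hbc k i
    grind
  have hmM : ∀ i k, m i ≠ M k := fun i k h => by
    have hi := hm i; have hk := hm k
    have := @hb i k; have := @hc i k; have := hbc i k; have := hbc k i
    grind
  refine ⟨m ∘ Tuple.sort m, M ∘ Tuple.sort m, (Tuple.sort m).symm, fun k => decide (b k < c k),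
    ?_, ?_, ?_, ?_, ?_⟩
  · exact Sum.elim_injective.2 ⟨hm_inj.comp (Equiv.injective _),
      hM_inj.comp (Equiv.injective _), fun i k => hmM _ _⟩
  · intro i
    have := hm (Tuple.sort m i)
    simp only [Function.comp]
    grind
  · exact (Tuple.monotone_sort m).strictMono_of_injective (hm_inj.comp (Equiv.injective _))
  · intro k
    have := hm k
    simp only [Function.comp, Equiv.apply_symm_apply, decide_eq_true_eq]
    grind
  · intro k
    have := hm k
    simp only [Function.comp, Equiv.apply_symm_apply, decide_eq_true_eq]
    grind

end Normalize

/-! ### The normalized products: degree, weight, duality and uniqueness. -/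

namespace PairData

variable {K : Type*} [Field K] {s r : ℕ}

theorem prod_indexSet {M : Type*} [CommMonoid M] (D : PairData K s r) (φ : Fin s → M) :
    ∏ j ∈ D.indexSet, φ j = ∏ i, (φ (D.b i) * φ (D.c i)) := by
  obtain ⟨hb, hc, hbc⟩ := Sum.elim_injective.1 D.distinct
  rw [indexSet, Finset.prod_union, Finset.prod_image fun _ _ _ _ h => hb h,
    Finset.prod_image fun _ _ _ _ h => hc h, Finset.prod_mul_distrib]
  rw [Finset.disjoint_left]
  intro j hj hj'
  simp only [Finset.mem_image, Finset.mem_univ, true_and] at hj hj'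
  obtain ⟨i, rfl⟩ := hj
  obtain ⟨k, hk⟩ := hj'
  exact hbc i k hk.symm

theorem torusEval_poly (D : PairData K s r) (x : Fin s → Kˣ) :
    torusEval D.poly x = D.lead * (∏ i, ((x (D.b i) : K) + D.coef i * x (D.c i))) *
      ∏ j ∈ D.indexSetᶜ, (x j : K) := by
  simp [torusEval, poly]

theorem card_indexSet (D : PairData K s r) : D.indexSet.card = 2 * r := by
  obtain ⟨hb, hc, hbc⟩ := Sum.elim_injective.1 D.distinct
  rw [indexSet, Finset.card_union_of_disjoint, Finset.card_image_of_injective _ hb,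
    Finset.card_image_of_injective _ hc, Finset.card_univ, Fintype.card_fin, two_mul]
  rw [Finset.disjoint_left]
  intro j hj hj'
  simp only [Finset.mem_image, Finset.mem_univ, true_and] at hj hj'
  obtain ⟨i, rfl⟩ := hj
  obtain ⟨k, hk⟩ := hj'
  exact hbc i k hk.symm

theorem isHomogeneous_poly (D : PairData K s r) : D.poly.IsHomogeneous (s - r) := by
  have h1 : (∏ i, (X (D.b i) + C (D.coef i : K) * X (D.c i))).IsHomogeneous (∑ _i : Fin r, 1) :=
    IsHomogeneous.prod _ _ _ fun i _ => (isHomogeneous_X _ _).add (by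
      simpa using (isHomogeneous_C (Fin s) (D.coef i : K)).mul (isHomogeneous_X K (D.c i)))
  have h2 : (∏ j ∈ D.indexSetᶜ, (X j : MvPolynomial (Fin s) K)).IsHomogeneous
      (∑ _j ∈ D.indexSetᶜ, 1) :=
    IsHomogeneous.prod _ _ _ fun i _ => isHomogeneous_X _ _
  have h3 := ((isHomogeneous_C (Fin s) (D.lead : K)).mul h1).mul h2
  have h4 := D.card_indexSet
  have h5 := D.indexSet.card_le_univ
  rw [← Finset.card_eq_sum_ones, ← Finset.card_eq_sum_ones, Finset.card_compl] at h3
  simp only [Finset.card_univ, Fintype.card_fin] at h3 h5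
  have : s - r = 0 + r + (s - D.indexSet.card) := by omega
  rw [this]
  exact h3

theorem degreeOf_poly_le (D : PairData K s r) (i : Fin s) : D.poly.degreeOf i ≤ 1 := by
  have h1 : (∏ k, (X (D.b k) + C (D.coef k : K) * X (D.c k))).degreeOf i ≤
      ∑ j ∈ D.indexSet, if i = j then 1 else 0 := by
    have : ∑ j ∈ D.indexSet, (if i = j then 1 else 0) =
        ∑ k, ((if i = D.b k then 1 else 0) + (if i = D.c k then 1 else 0)) :=
      -- The product formula read additively.
      D.prod_indexSet (M := Multiplicative ℕ) fun j => Multiplicative.ofAdd (if i = j then 1 else 0)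
    rw [this]
    refine (degreeOf_prod_le _ _ _).trans (Finset.sum_le_sum fun k _ => ?_)
    refine (degreeOf_add_le _ _ _).trans (max_le ?_ ?_)
    · rw [degreeOf_X]; omega
    · refine (degreeOf_C_mul_le _ _ _).trans ?_
      rw [degreeOf_X]; omega
  have h2 : (∏ j ∈ D.indexSetᶜ, (X j : MvPolynomial (Fin s) K)).degreeOf i ≤
      ∑ j ∈ D.indexSetᶜ, if i = j then 1 else 0 := by
    refine (degreeOf_prod_le _ _ _).trans (Finset.sum_le_sum fun k _ => ?_)
    rw [degreeOf_X]
  have h3 := Finset.sum_add_sum_compl D.indexSet fun j => if i = j then 1 else 0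
  have h3' : ∑ j, (if i = j then 1 else 0) = 1 := by simp
  rw [h3'] at h3
  have h4 := degreeOf_mul_le i (C (D.lead : K) *
    ∏ k, (X (D.b k) + C (D.coef k : K) * X (D.c k))) (∏ j ∈ D.indexSetᶜ, X j)
  have h5 := degreeOf_C_mul_le (∏ k, (X (D.b k) + C (D.coef k : K) * X (D.c k))) i (D.lead : K)
  rw [poly]
  omega

theorem isExtremal_poly [Fintype K] [DecidableEq K] (hK : 3 ≤ Fintype.card K)
    (D : PairData K s r) : IsExtremal r D.poly := by
  have h := hammingNorm_prod_binomial hK D.b D.c D.distinct D.coef Finset.univ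
  rw [Finset.card_univ, Fintype.card_fin] at h
  rw [IsExtremal, ← h]
  congr 1
  rw [hammingNorm_eq_sum, hammingNorm_eq_sum]
  refine Finset.sum_congr rfl fun x _ => ?_
  have : ∏ j ∈ D.indexSetᶜ, (x j : K) ≠ 0 :=
    Finset.prod_ne_zero_iff.2 fun i _ => Units.ne_zero _
  simp only [torusEval_poly, ne_eq, mul_eq_zero, this, or_false, Units.ne_zero, false_or]

/-- Since x_b x_c (1/x_b + α/x_c) = x_c + αx_b, each binomial stays a binomial in the same pair up
to a scalar; coordinates outside the pairs survive as monomial factors. -/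
theorem exists_torusEval_eq_complement (a : Kˣ) (α : Fin r → Kˣ) (b c : Fin r → Fin s)
    (hinj : Function.Injective (Sum.elim b c)) :
    ∃ D : PairData K s r, ∀ x, torusEval D.poly x = (∏ i, (x i : K)) *
      torusEval (C (a : K) * ∏ i, (X (b i) + C (α i : K) * X (c i))) x⁻¹ := by
  obtain ⟨b', c', τ, ε, hinj', hlt, hmono, hb, hc⟩ := exists_normalized b c hinj
  have key : ∀ k, ∃ γ δ : Kˣ, ∀ x : Fin s → Kˣ,
      (x (b' (τ k)) : K) * x (c' (τ k)) * ((x (b k) : K)⁻¹ + α k * (x (c k) : K)⁻¹) =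
        γ * ((x (b' (τ k)) : K) + δ * x (c' (τ k))) := by
    intro k
    rw [hb, hc]
    cases ε k
    · refine ⟨1, α k, fun x => ?_⟩
      simp only [Bool.false_eq_true, if_false]
      field_simp
      simp
    · refine ⟨α k, (α k)⁻¹, fun x => ?_⟩
      simp only [if_true, Units.val_inv_eq_inv_val]
      field_simp
      ring
  choose γ δ hγδ using key
  let D : PairData K s r := ⟨a * ∏ k, γ k, fun i => δ (τ.symm i), b', c', hinj', hlt, hmono⟩
  refine ⟨D, fun x => ?_⟩
  rw [torusEval_poly, ← Finset.prod_mul_prod_compl D.indexSet, D.prod_indexSet]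
  have h1 : torusEval (C (a : K) * ∏ i, (X (b i) + C (α i : K) * X (c i))) x⁻¹ =
      a * ∏ k, ((x (b k) : K)⁻¹ + α k * (x (c k) : K)⁻¹) := by
    simp [torusEval]
  have h2 : ∏ i, ((x (D.b i) : K) * x (D.c i)) = ∏ k, ((x (b' (τ k)) : K) * x (c' (τ k))) :=
    (Equiv.prod_comp τ fun i => (x (b' i) : K) * x (c' i)).symm
  have h3 : ∏ i, ((x (D.b i) : K) + D.coef i * x (D.c i)) =
      ∏ k, ((x (b' (τ k)) : K) + δ k * x (c' (τ k))) := by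
    rw [← Equiv.prod_comp τ]
    simp [D]
  have h4 : (∏ k, (γ k : K)) * ∏ k, ((x (b' (τ k)) : K) + δ k * x (c' (τ k))) =
      (∏ k, ((x (b' (τ k)) : K) * x (c' (τ k)))) *
        ∏ k, ((x (b k) : K)⁻¹ + α k * (x (c k) : K)⁻¹) := by
    rw [← Finset.prod_mul_distrib, ← Finset.prod_mul_distrib]
    exact Finset.prod_congr rfl fun k _ => (hγδ k x).symm
  have h5 : (D.lead : K) = a * ∏ k, (γ k : K) := by simp [D]
  rw [h1, h2, h3, h5]
  linear_combination (a : K) * (∏ j ∈ D.indexSetᶜ, (x j : K)) * h4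

/-- The binomials of `D` occur among those of any `D'` with the same polynomial. -/
theorem exists_eq_of_poly_eq {D D' : PairData K s r} (h : D.poly = D'.poly) (i : Fin r) :
    ∃ k, D'.b k = D.b i ∧ D'.c k = D.c i ∧ D'.coef k = D.coef i := by
  classical
  have hbc : D.c i ≠ D.b i := (D.b_lt_c i).ne'
  -- Substituting the root of the `i`-th binomial of `D` kills the common polynomial, hence some
  -- factor of `D'.poly`. Only a binomial with the same data can be killed.
  let θ : MvPolynomial (Fin s) K →ₐ[K] MvPolynomial (Fin s) K :=
    aeval (Function.update X (D.b i) (-(C (D.coef i : K) * X (D.c i))))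
  have hθb : θ (X (D.b i)) = -(C (D.coef i : K) * X (D.c i)) := by simp [θ]
  have hθ : ∀ j, j ≠ D.b i → θ (X j) = X j := fun j hj => by simp [θ, hj]
  have hθC : ∀ a : K, θ (C a) = C a := fun a => by simp [θ]
  have h0 : θ D'.poly = 0 := by
    rw [← h, poly, map_mul, map_mul, map_prod]
    rw [Finset.prod_eq_zero (Finset.mem_univ i), mul_zero, zero_mul]
    rw [map_add, map_mul, hθb, hθ _ hbc, hθC]; ring
  rw [poly, map_mul, map_mul, map_prod, map_prod, hθC, mul_eq_zero, mul_eq_zero,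
    Finset.prod_eq_zero_iff, Finset.prod_eq_zero_iff] at h0
  rcases h0 with (h0 | ⟨k, -, hk⟩) | ⟨j, -, hj⟩
  · simp at h0
  · refine ⟨k, ?_⟩
    rw [map_add, map_mul, hθC] at hk
    have hlt := D'.b_lt_c k
    have hlt' := D.b_lt_c i
    by_cases hb : D'.b k = D.b i
    · have hc : D'.c k ≠ D.b i := by rw [← hb]; exact hlt.ne'
      rw [hb, hθb, hθ _ hc] at hk
      have h1 := congrArg (coeff (Finsupp.single (D.c i) 1)) hk
      simp only [coeff_add, coeff_neg, coeff_C_mul, coeff_X, coeff_zero,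
        Finsupp.single_left_inj one_ne_zero] at h1
      by_cases hcc : D'.c k = D.c i
      · refine ⟨hb, hcc, Units.ext ?_⟩
        simp only [hcc, if_true] at h1
        linear_combination h1
      · simp [hcc] at h1
    · by_cases hc : D'.c k = D.b i
      · rw [hc, hθb, hθ _ hb] at hk
        have h1 := congrArg (coeff (Finsupp.single (D'.b k) 1)) hk
        -- Otherwise the pair would be the same one in reverse order, against `b < c` on both sides.
        have hne : D.c i ≠ D'.b k := by
          intro hh
          rw [← hc, hh] at hlt'
          exact absurd hlt' hlt.not_gt
        simp [coeff_X, coeff_C_mul, Finsupp.single_left_inj, hne] at h1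
      · rw [hθ _ hb, hθ _ hc] at hk
        have h1 := congrArg (coeff (Finsupp.single (D'.b k) 1)) hk
        simp [coeff_X, coeff_C_mul, Finsupp.single_left_inj, hlt.ne'] at h1
  · exfalso
    by_cases hb : j = D.b i
    · rw [hb, hθb] at hj
      simp at hj
    · rw [hθ _ hb] at hj
      simp at hj

theorem poly_injective [Fintype K] [DecidableEq K] (hK : 3 ≤ Fintype.card K) :
    Function.Injective (poly : PairData K s r → MvPolynomial (Fin s) K) := by
  intro D D' h
  have hb : D.b = D'.b := by
    refine (StrictMono.range_inj D.b_strictMono D'.b_strictMono).1 (Set.Subset.antisymm ?_ ?_)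
    · rintro _ ⟨i, rfl⟩
      obtain ⟨k, hk, -⟩ := exists_eq_of_poly_eq h i
      exact ⟨k, hk⟩
    · rintro _ ⟨i, rfl⟩
      obtain ⟨k, hk, -⟩ := exists_eq_of_poly_eq h.symm i
      exact ⟨k, hk⟩
  have hcc : ∀ i, D.c i = D'.c i ∧ D.coef i = D'.coef i := fun i => by
    obtain ⟨k, hk, hc, hα⟩ := exists_eq_of_poly_eq h i
    rw [hb] at hk
    obtain rfl := D'.b_strictMono.injective hk
    exact ⟨hc.symm, hα.symm⟩
  -- At a point where the polynomial is nonzero the other factors cancel, leaving the leading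
  -- scalars.
  obtain ⟨x, hx⟩ := (D.isExtremal_poly hK).exists_torusEval_ne_zero hK
  have hev : torusEval D.poly x = torusEval D'.poly x := by rw [h]
  rcases D with ⟨l, α, b, c, h1, h2, h3⟩
  rcases D' with ⟨l', α', b', c', h1', h2', h3'⟩
  obtain rfl : b = b' := hb
  obtain rfl : c = c' := funext fun i => (hcc i).1
  obtain rfl : α = α' := funext fun i => (hcc i).2
  obtain rfl : l = l' := by
    rw [torusEval_poly] at hx
    rw [torusEval_poly, torusEval_poly] at hev
    have h4 := right_ne_zero_of_mul hx
    have h5 := right_ne_zero_of_mul (left_ne_zero_of_mul hx)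
    exact Units.ext (mul_right_cancel₀ h5 (mul_right_cancel₀ h4 hev))
  rfl

end PairData

/-! ### Counting the normalized data. -/

namespace PairData

/-- Forget the normalization of `PairData`: reorder the pairs by a permutation, and swap those
pairs at which the Boolean function is `false`. -/
noncomputable def toEmbedding {K : Type*} [Field K] {s r : ℕ}
    (p : PairData K s r × Equiv.Perm (Fin r) × (Fin r → Bool)) :
    (Kˣ × (Fin r → Kˣ)) × (Fin r ⊕ Fin r ↪ Fin s) :=
  ((p.1.lead, p.1.coef),
    ⟨Sum.elim (fun k => if p.2.2 k then p.1.b (p.2.1 k) else p.1.c (p.2.1 k))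
      (fun k => if p.2.2 k then p.1.c (p.2.1 k) else p.1.b (p.2.1 k)), by
      obtain ⟨hb, hc, hbc⟩ := Sum.elim_injective.1 p.1.distinct
      have hτ := p.2.1.injective
      refine Sum.elim_injective.2 ⟨fun i k h => ?_, fun i k h => ?_, fun i k h => ?_⟩
      all_goals
        have h1 := @hτ i k
        have h2 := @hb (p.2.1 i) (p.2.1 k)
        have h3 := @hc (p.2.1 i) (p.2.1 k)
        have h4 := hbc (p.2.1 i) (p.2.1 k)
        have h5 := hbc (p.2.1 k) (p.2.1 i)
        grind⟩)

/-- The order within a pair recovers `ε`; the range of the smaller indices recovers the increasing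
`b`, which then determines `τ` and `c`. Surjectivity is `exists_normalized`. -/
theorem toEmbedding_bijective {K : Type*} [Field K] {s r : ℕ} :
    Function.Bijective (toEmbedding (K := K) (s := s) (r := r)) := by
  constructor
  · rintro ⟨⟨l, α, b, c, h1, h2, h3⟩, τ, ε⟩ ⟨⟨l', α', b', c', h1', h2', h3'⟩, τ', ε'⟩ h
    simp only [toEmbedding, Prod.mk.injEq, Function.Embedding.mk.injEq] at h
    obtain ⟨⟨rfl, rfl⟩, h⟩ := h
    have hl : ∀ k, (if ε k then b (τ k) else c (τ k)) = if ε' k then b' (τ' k) else c' (τ' k) :=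
      fun k => congrFun h (Sum.inl k)
    have hr : ∀ k, (if ε k then c (τ k) else b (τ k)) = if ε' k then c' (τ' k) else b' (τ' k) :=
      fun k => congrFun h (Sum.inr k)
    have key : ∀ k, ε k = ε' k ∧ b (τ k) = b' (τ' k) ∧ c (τ k) = c' (τ' k) := fun k => by
      have e1 := hl k
      have e2 := hr k
      have e3 := h2 (τ k)
      have e4 := h2' (τ' k)
      cases hε : ε k <;> cases hε' : ε' k <;> simp only [hε, hε', if_true, Bool.false_eq_true,
        if_false] at e1 e2
      · exact ⟨rfl, e2, e1⟩
      · rw [e1, e2] at e3; exact absurd e3 e4.not_gt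
      · rw [e1, e2] at e3; exact absurd e3 e4.not_gt
      · exact ⟨rfl, e1, e2⟩
    obtain rfl : ε = ε' := funext fun k => (key k).1
    obtain rfl : b = b' := by
      refine (StrictMono.range_inj h3 h3').1 ?_
      rw [← τ.surjective.range_comp b, ← τ'.surjective.range_comp b']
      exact congrArg Set.range (funext fun k => (key k).2.1)
    obtain rfl : τ = τ' := Equiv.ext fun k => h3.injective (key k).2.1
    obtain rfl : c = c' := funext fun i => by
      simpa using (key (τ.symm i)).2.2
    rfl
  · rintro ⟨⟨l, α⟩, φ⟩
    obtain ⟨b, c, τ, ε, h1, h2, h3, hl, hr⟩ := exists_normalized (φ ∘ Sum.inl) (φ ∘ Sum.inr) (by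
      rw [← Sum.comp_elim]
      simpa using φ.injective)
    refine ⟨⟨⟨l, α, b, c, h1, h2, h3⟩, τ, ε⟩, ?_⟩
    simp only [toEmbedding, Prod.mk.injEq, true_and]
    ext x
    rcases x with k | k
    · exact congrArg Fin.val (hl k).symm
    · exact congrArg Fin.val (hr k).symm

theorem card_mul {K : Type*} [Field K] [Fintype K] [DecidableEq K] (s r : ℕ) :
    Nat.card (PairData K s r) * (r.factorial * 2 ^ r) =
      (Fintype.card K - 1) ^ (r + 1) * s.descFactorial (2 * r) := by
  have h := Nat.card_congr (Equiv.ofBijective _ (toEmbedding_bijective (K := K) (s := s) (r := r)))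
  rw [Nat.card_prod, Nat.card_prod, Nat.card_prod, Nat.card_prod] at h
  simp only [Nat.card_eq_fintype_card (α := Equiv.Perm (Fin r)), Fintype.card_perm,
    Nat.card_eq_fintype_card (α := Fin r → Bool), Fintype.card_fun, Fintype.card_fin,
    Fintype.card_bool, Nat.card_eq_fintype_card (α := Kˣ),
    Nat.card_eq_fintype_card (α := Fin r → Kˣ), Fintype.card_units,
    Nat.card_eq_fintype_card (α := Fin r ⊕ Fin r ↪ Fin s), Fintype.card_embedding_eq,
    Fintype.card_sum, ← two_mul] at h
  rw [h]; ring

end PairData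

/-! ### Minimum weight codewords of the code. -/

section Code

variable {K : Type*} [Field K] {s d : ℕ}

theorem isMonomiallySquareFree_iff {f : MvPolynomial (Fin s) K} :
    IsMonomiallySquareFree f ↔ ∀ i, f.degreeOf i ≤ 1 := by
  simp only [degreeOf_le_iff, IsMonomiallySquareFree]
  exact ⟨fun h i m hm => h m hm i, fun h m hm i => h i m hm⟩

theorem mem_code_iff {v : Torus K s → K} :
    v ∈ code K s d ↔ ∃ f : MvPolynomial (Fin s) K,
      (∀ i, f.degreeOf i ≤ 1) ∧ f.IsHomogeneous d ∧ torusEval f = v := by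
  constructor
  · rintro ⟨y, hy, rfl⟩
    suffices ∃ f : MvPolynomial (Fin s) K, (∀ i, f.degreeOf i ≤ 1) ∧ f.IsHomogeneous d ∧
        Ideal.Quotient.mk (torusIdeal K s) f = y by
      obtain ⟨f, h1, h2, rfl⟩ := this
      exact ⟨f, h1, h2, rfl⟩
    refine Submodule.span_induction ?_ ?_ ?_ ?_ hy
    · rintro _ ⟨a, ha, had, rfl⟩
      refine ⟨monomial a 1, fun i => ?_, isHomogeneous_monomial _ ?_, rfl⟩
      · rw [degreeOf_monomial_eq _ _ one_ne_zero]; exact ha i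
      · rw [Finsupp.degree_eq_sum, had]
    · exact ⟨0, by simp, isHomogeneous_zero _ _ _, map_zero _⟩
    · rintro _ _ _ _ ⟨f, h1, h2, rfl⟩ ⟨g, h3, h4, rfl⟩
      exact ⟨f + g, fun i => (degreeOf_add_le _ _ _).trans (max_le (h1 i) (h3 i)), h2.add h4,
        map_add _ _ _⟩
    · rintro a _ _ ⟨f, h1, h2, rfl⟩
      refine ⟨C a * f, fun i => (degreeOf_C_mul_le _ _ _).trans (h1 i), ?_, ?_⟩
      · simpa using (isHomogeneous_C _ a).mul h2
      · rw [← smul_eq_C_mul]; rfl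
  · rintro ⟨f, h1, h2, rfl⟩
    refine ⟨Ideal.Quotient.mk (torusIdeal K s) f, ?_, rfl⟩
    rw [f.as_sum, map_sum]
    refine Submodule.sum_mem _ fun m hm => ?_
    have h3 : monomial m (coeff m f) = (coeff m f) • (monomial m 1 : MvPolynomial (Fin s) K) := by
      simp [smul_monomial]
    have h4 : Ideal.Quotient.mk (torusIdeal K s) (monomial m (coeff m f)) =
        coeff m f • Ideal.Quotient.mk (torusIdeal K s) (monomial m 1) := by
      rw [h3]; rfl
    rw [h4]
    refine Submodule.smul_mem _ _ (Submodule.subset_span ⟨m, fun i =>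
      (monomial_le_degreeOf i hm).trans (h1 i), ?_, rfl⟩)
    have := h2 (mem_support_iff.1 hm)
    rw [← Finsupp.degree_eq_sum, Finsupp.degree_eq_weight_one]
    exact this

/-- Supplies a codeword attaining the weight bound; s ≤ 2d is what leaves room for s - d disjoint
pairs. -/
theorem nonempty_pairData {r : ℕ} (hr : 2 * r ≤ s) : Nonempty (PairData K s r) := by
  refine ⟨⟨1, 1, fun i => ⟨i, by omega⟩, fun i => ⟨r + i, by omega⟩, ?_, ?_, ?_⟩⟩
  · refine Sum.elim_injective.2 ⟨fun i k h => ?_, fun i k h => ?_, fun i k h => ?_⟩ <;>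
      simp only [Fin.mk.injEq] at h <;> omega
  · intro i
    simp only [Fin.mk_lt_mk]; omega
  · intro i k h
    simpa using h

variable [Fintype K]

theorem torusEval_injOn (hq : 4 ≤ Fintype.card K) {f g : MvPolynomial (Fin s) K}
    (hf : ∀ i, f.degreeOf i ≤ 1) (hg : ∀ i, g.degreeOf i ≤ 1) (h : torusEval f = torusEval g) :
    f = g := by
  rw [← sub_eq_zero]
  refine eq_zero_of_torusEval (fun i => ?_) (fun x => ?_)
  · have := (degreeOf_sub_le i f g).trans (max_le (hf i) (hg i))
    omega
  · have := congrFun h x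
    rw [torusEval, torusEval] at this
    rw [torusEval, map_sub, this, sub_self]

variable [DecidableEq K]

theorem isExtremal_iff_exists_pairData (hq : 4 ≤ Fintype.card K) {f : MvPolynomial (Fin s) K}
    (hf : ∀ i, f.degreeOf i ≤ 1) (hom : f.IsHomogeneous d) :
    IsExtremal (s - d) f ↔ ∃ D : PairData K s (s - d), f = D.poly := by
  constructor
  · intro h
    obtain ⟨g, hg, homg, hev⟩ := exists_complement hf hom
    rw [Fintype.card_fin] at homg
    have hgext : IsExtremal (s - d) g := by
      rw [IsExtremal, hammingNorm_comp_inv hev]; exact h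
    obtain ⟨a, α, b, c, hinj, hprod⟩ := hgext.exists_prod hq _ hg homg
    obtain ⟨D, hD⟩ := PairData.exists_torusEval_eq_complement a α b c hinj
    refine ⟨D, torusEval_injOn hq hf D.degreeOf_poly_le (funext fun x => ?_)⟩
    -- Complementing twice gives back `f` on the torus.
    rw [hD, ← hprod, hev, inv_inv, ← mul_assoc, ← Finset.prod_mul_distrib]
    simp
  · rintro ⟨D, rfl⟩
    exact D.isExtremal_poly (by omega)

theorem isMinWeightCodeword_iff (hq : 4 ≤ Fintype.card K) (hsd : s ≤ 2 * d) (hds : d ≤ s)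
    {f : MvPolynomial (Fin s) K} (hf : ∀ i, f.degreeOf i ≤ 1) (hom : f.IsHomogeneous d) :
    IsMinWeightCodeword (code K s d) (torusEval f) ↔ IsExtremal (s - d) f := by
  have hN : Fintype.card Kˣ = Fintype.card K - 1 := Fintype.card_units K
  have hpos : 0 < Fintype.card Kˣ ^ (s - d) := pow_pos (by omega) _
  have bound : ∀ w ∈ code K s d, w ≠ 0 →
      (Fintype.card Kˣ - 1) ^ (s - d) * Fintype.card (Fin s → Kˣ) ≤
        Fintype.card Kˣ ^ (s - d) * hammingNorm w := by
    intro w hw hw0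
    obtain ⟨g, hg, homg, rfl⟩ := mem_code_iff.1 hw
    simpa using hammingNorm_torusEval_ge_of_codegree (by omega) hg homg hw0
  have hmem : torusEval f ∈ code K s d := mem_code_iff.2 ⟨f, hf, hom, rfl⟩
  constructor
  · rintro ⟨-, h0, hmin⟩
    obtain ⟨D⟩ := nonempty_pairData (K := K) (s := s) (r := s - d) (by omega)
    have hD := D.isExtremal_poly (by omega)
    have hom' : D.poly.IsHomogeneous d := by
      have := D.isHomogeneous_poly
      rwa [Nat.sub_sub_self hds] at this
    have hD0 : torusEval D.poly ≠ 0 := by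
      obtain ⟨x, hx⟩ := hD.exists_torusEval_ne_zero (by omega)
      exact fun h => hx (congrFun h x)
    have h1 := hmin _ (mem_code_iff.2 ⟨_, D.degreeOf_poly_le, hom', rfl⟩) hD0
    refine le_antisymm ?_ (bound _ hmem h0)
    rw [← hD]
    exact Nat.mul_le_mul_left _ h1
  · intro h
    refine ⟨hmem, ?_, fun w hw hw0 => ?_⟩
    · obtain ⟨x, hx⟩ := h.exists_torusEval_ne_zero (by omega)
      exact fun h => hx (congrFun h x)
    · refine Nat.le_of_mul_le_mul_left ?_ hpos
      exact h.le.trans (bound w hw hw0)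

theorem ncard_isMinWeightCodeword (hq : 4 ≤ Fintype.card K) (hsd : s ≤ 2 * d) (hds : d ≤ s) :
    {v | IsMinWeightCodeword (code K s d) v}.ncard = Nat.card (PairData K s (s - d)) := by
  have hom (D : PairData K s (s - d)) : D.poly.IsHomogeneous d := by
    have := D.isHomogeneous_poly
    rwa [Nat.sub_sub_self hds] at this
  let Φ : PairData K s (s - d) → {v | IsMinWeightCodeword (code K s d) v} := fun D =>
    ⟨torusEval D.poly, (isMinWeightCodeword_iff hq hsd hds D.degreeOf_poly_le (hom D)).2
      (D.isExtremal_poly (by omega))⟩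
  refine (Nat.card_congr (Equiv.ofBijective Φ ⟨fun D D' h => ?_, ?_⟩)).symm
  · exact PairData.poly_injective (by omega) (torusEval_injOn hq D.degreeOf_poly_le
      D'.degreeOf_poly_le (congrArg Subtype.val h))
  · rintro ⟨v, hv⟩
    obtain ⟨f, hf, homf, rfl⟩ := mem_code_iff.1 hv.1
    obtain ⟨D, rfl⟩ := (isExtremal_iff_exists_pairData hq hf homf).1
      ((isMinWeightCodeword_iff hq hsd hds hf homf).1 hv)
    exact ⟨D, rfl⟩

end Code

end HypersimplexCode

theorem corollary2p4 (K : Type*) [Field K] [Fintype K] [DecidableEq K] (q : ℕ)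
    (hK : Fintype.card K = q) (hq : 4 ≤ q) (s d : ℕ) (hsd : s < 2 * d) (hds : 2 * d < 2 * s) :
    (∀ f : MvPolynomial (Fin s) K, f.IsHomogeneous d →
      HypersimplexCode.IsMonomiallySquareFree f →
        (HypersimplexCode.IsMinWeightCodeword (HypersimplexCode.code K s d)
            (HypersimplexCode.phi K s
              (Ideal.Quotient.mk (HypersimplexCode.torusIdeal K s) f)) ↔
          ∃ D : HypersimplexCode.PairData K s (s - d), f = D.poly) ∧
        (∀ D D' : HypersimplexCode.PairData K s (s - d),
          f = D.poly → f = D'.poly → D = D')) ∧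
    (({v | HypersimplexCode.IsMinWeightCodeword (HypersimplexCode.code K s d) v}.ncard : ℕ) : ℚ) =
      ((q : ℚ) - 1) ^ (s - d + 1) * (∏ i ∈ Finset.range (2 * s - 2 * d), ((s : ℚ) - (i : ℚ))) /
        ((Nat.factorial (s - d) : ℚ) * 2 ^ (s - d)) := by
  subst hK
  refine ⟨fun f hom hf => ⟨?_, fun D D' h h' => ?_⟩, ?_⟩
  · rw [HypersimplexCode.isMonomiallySquareFree_iff] at hf
    exact (HypersimplexCode.isMinWeightCodeword_iff hq hsd.le (by omega) hf hom).trans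
      (HypersimplexCode.isExtremal_iff_exists_pairData hq hf hom)
  · exact HypersimplexCode.PairData.poly_injective (by omega) (h.symm.trans h')
  · rw [HypersimplexCode.ncard_isMinWeightCodeword hq hsd.le (by omega), eq_div_iff (by positivity)]
    have h := congrArg (Nat.cast (R := ℚ))
      (HypersimplexCode.PairData.card_mul (K := K) s (s - d))
    have h1 : 2 * s - 2 * d = 2 * (s - d) := by omega
    have h2 : ((s.descFactorial (2 * (s - d)) : ℕ) : ℚ) =
        ∏ i ∈ Finset.range (2 * (s - d)), ((s : ℚ) - (i : ℚ)) := by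
      rw [Nat.descFactorial_eq_prod_range, Nat.cast_prod]
      refine Finset.prod_congr rfl fun i hi => ?_
      rw [Finset.mem_range] at hi
      -- The subtraction is not truncated: i < 2(s-d) < s.
      rw [Nat.cast_sub (by omega)]
    push_cast [Nat.cast_sub (show 1 ≤ Fintype.card K by omega)] at h
    rw [h1, ← h2, ← h]
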